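/- Permutations are written in one-line notation, as words. Let $\mathbf{S}$ be the stack sorting operator, $\mathbf{S}(\varepsilon)=\varepsilon$ and $\mathbf{S}(\alpha n\beta)=\mathbf{S}(\alpha)\,\mathbf{S}(\beta)\,n$, where $n$ is the maximum of the word $\alpha n\beta$ of distinct values, and let $\mathbf{R}$ be reversal of words. For a word of distinct values let $\mathrm{T_{in}}(\varepsilon)$ be the empty tree and let $\mathrm{T_{in}}(\alpha n\beta)$ be the binary tree with root $n$, left subtree $\mathrm{T_{in}}(\alpha)$ and right subtree $\mathrm{T_{in}}(\beta)$; this is the decreasing binary tree whose in-order reading is the given word. Write $\alpha\oplus\beta=\alpha\,(\beta+|\alpha|)$ and $\alpha\ominus\beta=(\alpha+|\beta|)\,\beta$. A permutation is in $\mathrm{Av}(231)$ if it has no subword $b\,c\,a$ (not necessarily consecutive) with $a<b<c$. Every nonempty $\pi\in\mathrm{Av}(231)$ is uniquely $\alpha\oplus(1\ominus\beta)$ with $\alpha,\beta\in\mathrm{Av}(231)$ possibly empty, and the map $P$ on $\mathrm{Av}(231)$ is defined by $P(\varepsilon)=\varepsilon$ and $P(\alpha\oplus(1\ominus\beta))=(P(\alpha)\oplus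 1)\ominus P(\beta)$. For $\pi\in\mathrm{Av}(231)$ of size $n$ let $\lambda_\pi$ be the permutation of $\{1,\dots,n\}$ with $P(\pi)=\lambda_\pi\circ\pi$; applying $\lambda_\pi$ to a tree with labels in $\{1,\dots,n\}$ means applying it to each label. Theorem. Let $\mathbf{A}$ be any operator on permutations formed by composition from $\{\mathbf{S},\mathbf{R}\}$ (the identity, as the empty composition, is allowed). For a permutation $\pi$ let $\mathbf{A}^{-1}(\pi)$ be the set of permutations $\theta$ with $\mathbf{A}(\theta)=\pi$, and for $\theta$ with $\mathbf{A}(\theta)\in\mathrm{Av}(231)$ put $\Phi_{\mathbf{A}}(\theta)=\lambda_{\mathbf{A}(\theta)}\circ\theta$. Then $\mathbf{A}$ respects $P$, that is, for every $\pi\in\mathrm{Av}(231)$ in the image of $\mathbf{A}$: 1. for every $\theta\in\mathbf{A}^{-1}(\pi)$ (so that $\Phi_{\mathbf{A}}(\theta)=\lambda_\pi\circ\theta$) we have $\mathbf{A}(\Phi_{\mathbf{A}}(\theta))=P(\pi)=\lambda_\pi\circ\pi$ and $\mathrm{T_{in}}(\Phi_{\mathbf{A}}(\theta))=\lambda_\pi(\mathrm{T_{in}}(\theta))$;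 2. $\theta\mapsto\Phi_{\mathbf{A}}(\theta)$ is a bijection from $\mathbf{A}^{-1}(\pi)$ onto $\mathbf{A}^{-1}(P(\pi))$. -/

import Mathlib

namespace StackSort

/-! Permutations are written in one-line notation, as words (lists) of natural numbers. -/

/-- `π` is a permutation of `[n] = {1, …, n}`, where `n` is its length. -/
def IsPermutation (π : List ℕ) : Prop :=
  π.Perm (List.range' 1 π.length)

/-- `π` avoids the pattern `231`: it has no (not necessarily consecutive) subword `b c a`
with `a < b < c`. -/
def Avoids231 (π : List ℕ) : Prop :=
  ∀ a b c : ℕ, a < b → b < c → ¬ List.Sublist [b, c, a] π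

/-! A nonempty word of distinct values is written `α n β`, where `n` is its maximum. -/

/-- The maximum of a word (`0` for the empty word). -/
def maxVal (l : List ℕ) : ℕ := l.foldr max 0

/-- The part `α` of `α n β`. -/
def beforeMax (l : List ℕ) : List ℕ := l.take (l.idxOf (maxVal l))

/-- The part `β` of `α n β`. -/
def afterMax (l : List ℕ) : List ℕ := l.drop (l.idxOf (maxVal l) + 1)

theorem maxVal_mem {l : List ℕ} (h : l ≠ []) : maxVal l ∈ l := by
  induction l with
  | nil => exact absurd rfl h
  | cons x xs ih =>
    by_cases hx : xs = []
    · subst hx; simp [maxVal]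
    · have h1 := ih hx
      have h2 : maxVal (x :: xs) = max x (maxVal xs) := rfl
      rw [h2]
      rcases le_total x (maxVal xs) with h3 | h3
      · rw [max_eq_right h3]; exact List.mem_cons_of_mem _ h1
      · rw [max_eq_left h3]; exact List.mem_cons_self

theorem length_beforeMax_lt {l : List ℕ} (h : l ≠ []) :
    (beforeMax l).length < l.length := by
  have h1 := List.idxOf_lt_length_of_mem (maxVal_mem h)
  rw [beforeMax, List.length_take]
  omega

theorem length_afterMax_lt {l : List ℕ} (h : l ≠ []) :
    (afterMax l).length < l.length := by
  have h1 := List.length_pos_iff.mpr h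
  rw [afterMax, List.length_drop]
  omega

/-- The stack sorting operator: `S(ε) = ε` and `S(α n β) = S(α) S(β) n`. -/
def S (l : List ℕ) : List ℕ :=
  if h : l = [] then []
  else S (beforeMax l) ++ S (afterMax l) ++ [maxVal l]
termination_by l.length
decreasing_by
  · exact length_beforeMax_lt h
  · exact length_afterMax_lt h

/-- The reversal operator. -/
def R (l : List ℕ) : List ℕ := l.reverse

/-- The decreasing binary tree whose in-order reading is the given word: `Tin(ε)` is the empty
tree and `Tin(α n β)` has root `n`, left subtree `Tin(α)` and right subtree `Tin(β)`. -/
def Tin (l : List ℕ) : BinaryTree ℕ :=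
  if h : l = [] then BinaryTree.nil
  else BinaryTree.node (maxVal l) (Tin (beforeMax l)) (Tin (afterMax l))
termination_by l.length
decreasing_by
  · exact length_beforeMax_lt h
  · exact length_afterMax_lt h

/-- The sum `α ⊕ β = α (β + |α|)`. -/
def oplus (α β : List ℕ) : List ℕ := α ++ β.map (· + α.length)

/-- The skew sum `α ⊖ β = (α + |β|) β`. -/
def ominus (α β : List ℕ) : List ℕ := α.map (· + β.length) ++ β

/-- The map `P` from `231`-avoiding to `132`-avoiding permutations:
`P(ε) = ε` and `P(α ⊕ (1 ⊖ β)) = (P(α) ⊕ 1) ⊖ P(β)` (see `P_oplus` below).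
In `α ⊕ (1 ⊖ β)` the word before the maximum is `α` and the word after it is `β + |α|`.
Values on words that are not `231`-avoiding permutations are irrelevant. -/
def P (l : List ℕ) : List ℕ :=
  if h : l = [] then []
  else ominus (oplus (P (beforeMax l)) [1])
    (P ((afterMax l).map (· - (beforeMax l).length)))
termination_by l.length
decreasing_by
  · exact length_beforeMax_lt h
  · rw [List.length_map]; exact length_afterMax_lt h

/-- The relabeling `λ_π`, sending the value `π(i)` to `P(π)(i)`, so that `P(π) = λ_π ∘ π`.
Numbers that are not values of `π` are fixed. -/
def lam (π : List ℕ) (v : ℕ) : ℕ := (P π).getD (π.idxOf v) v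

/-- The map `Φ_A`, `Φ_A(θ) = λ_{A(θ)} ∘ θ`. -/
def Phi (A : List ℕ → List ℕ) (θ : List ℕ) : List ℕ := θ.map (lam (A θ))

/-- The operators formed by composition from `{S, R}` (the identity being the empty one). -/
inductive IsComposition : (List ℕ → List ℕ) → Prop
  | ident : IsComposition id
  | stack : IsComposition S
  | rev : IsComposition R
  | comp {A B : List ℕ → List ℕ} :
      IsComposition A → IsComposition B → IsComposition (A ∘ B)

/-- The set `A⁻¹(π)` of all permutations `θ` with `A(θ) = π`. -/
def preimages (A : List ℕ → List ℕ) (π : List ℕ) : Set (List ℕ) :=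
  {θ | IsPermutation θ ∧ A θ = π}

/-- The operator `A` respects `P`. -/
def RespectsP (A : List ℕ → List ℕ) : Prop :=
  ∀ π : List ℕ, IsPermutation π → Avoids231 π → (preimages A π).Nonempty →
    (∀ θ ∈ preimages A π,
      A (Phi A θ) = P π ∧ P π = π.map (lam π) ∧
      Phi A θ = θ.map (lam π) ∧
      Tin (Phi A θ) = (Tin θ).map (lam π)) ∧
    Set.BijOn (Phi A) (preimages A π) (preimages A (P π))

/-! The recursive equations in the form `α n β`. -/

theorem maxVal_eq {α β : List ℕ} {n : ℕ} (hα : ∀ x ∈ α, x < n) (hβ : ∀ x ∈ β, x < n) :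
    maxVal (α ++ n :: β) = n := by
  have hb : ∀ l : List ℕ, (∀ x ∈ l, x < n) → maxVal l ≤ n := by
    intro l hl
    by_cases h : l = []
    · subst h; exact Nat.zero_le _
    · exact (hl _ (maxVal_mem h)).le
  induction α with
  | nil => exact max_eq_left (hb β hβ)
  | cons x xs ih =>
    have h1 := ih (fun y hy => hα y (List.mem_cons_of_mem _ hy))
    have h2 : maxVal (x :: xs ++ n :: β) = max x (maxVal (xs ++ n :: β)) := rfl
    rw [h2, h1]
    exact max_eq_right (hα x List.mem_cons_self).le

theorem idxOf_max {α β : List ℕ} {n : ℕ} (hα : ∀ x ∈ α, x < n) :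
    (α ++ n :: β).idxOf n = α.length := by
  rw [List.idxOf_append_of_notMem (fun h => lt_irrefl _ (hα n h))]
  simp

theorem beforeMax_eq {α β : List ℕ} {n : ℕ} (hα : ∀ x ∈ α, x < n) (hβ : ∀ x ∈ β, x < n) :
    beforeMax (α ++ n :: β) = α := by
  rw [beforeMax, maxVal_eq hα hβ, idxOf_max hα]
  simp

theorem afterMax_eq {α β : List ℕ} {n : ℕ} (hα : ∀ x ∈ α, x < n) (hβ : ∀ x ∈ β, x < n) :
    afterMax (α ++ n :: β) = β := by
  rw [afterMax, maxVal_eq hα hβ, idxOf_max hα]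
  simp

theorem S_eq {α β : List ℕ} {n : ℕ} (hα : ∀ x ∈ α, x < n) (hβ : ∀ x ∈ β, x < n) :
    S (α ++ n :: β) = S α ++ S β ++ [n] := by
  rw [S, dif_neg (by simp), beforeMax_eq hα hβ, afterMax_eq hα hβ, maxVal_eq hα hβ]

theorem Tin_eq {α β : List ℕ} {n : ℕ} (hα : ∀ x ∈ α, x < n) (hβ : ∀ x ∈ β, x < n) :
    Tin (α ++ n :: β) = BinaryTree.node n (Tin α) (Tin β) := by
  rw [Tin, dif_neg (by simp), beforeMax_eq hα hβ, afterMax_eq hα hβ, maxVal_eq hα hβ]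

theorem IsPermutation.le_length {π : List ℕ} (h : IsPermutation π) {x : ℕ} (hx : x ∈ π) :
    x ≤ π.length := by
  have h1 := h.mem_iff.mp hx
  rw [List.mem_range'_1] at h1
  omega

theorem P_oplus {α β : List ℕ} (hα : IsPermutation α) (hβ : IsPermutation β) :
    P (oplus α (ominus [1] β)) = ominus (oplus (P α) [1]) (P β) := by
  have h0 : oplus α (ominus [1] β)
      = α ++ (1 + β.length + α.length) :: β.map (· + α.length) := by
    simp [oplus, ominus]
  have h1 : ∀ x ∈ α, x < 1 + β.length + α.length := by
    intro x hx
    have := hα.le_length hx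
    omega
  have h2 : ∀ x ∈ β.map (· + α.length), x < 1 + β.length + α.length := by
    intro x hx
    obtain ⟨y, hy, rfl⟩ := List.mem_map.mp hx
    have := hβ.le_length hy
    show y + α.length < _
    omega
  have h3 : (β.map (· + α.length)).map (· - α.length) = β := by
    rw [List.map_map]
    conv_rhs => rw [← List.map_id β]
    exact List.map_congr_left (fun x _ => Nat.add_sub_cancel x α.length)
  rw [h0, P, dif_neg (by simp), beforeMax_eq h1 h2, afterMax_eq h1 h2, h3]

end StackSort

namespace StackSort

/-! The map `P` changes labels but not the shape of the decreasing tree (`P_spec`), so `lam π`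
increases along every ancestor relation of the tree of `π`; this is `Compat`. Such relabelings
commute with `S` and `R`, since both operators are determined by the tree. Ancestor pairs of a word
remain ancestor pairs after applying `S` or `R`, so compatibility passes from `A θ` back to `θ`
(`IsComposition.compat`). Hence `A (θ.map (lam π)) = (A θ).map (lam π) = P π`, with the tree
relabeled accordingly. An inverse of `lam π` on the letters of `π` is compatible with `P π`, and the
same argument for it gives surjectivity. -/

/-! ### Compatible relabelings and tree shapes -/

/-- `f` is strictly increasing along every ancestor relation of the decreasing binary tree
of the word `l`. -/
inductive Compat (f : ℕ → ℕ) : List ℕ → Prop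
  | nil : Compat f []
  | node {α β : List ℕ} {n : ℕ} (hα : ∀ x ∈ α, x < n) (hβ : ∀ x ∈ β, x < n)
      (hfα : ∀ x ∈ α, f x < f n) (hfβ : ∀ x ∈ β, f x < f n)
      (cα : Compat f α) (cβ : Compat f β) : Compat f (α ++ n :: β)

/-- The words `l` and `l'` have decreasing binary trees of the same shape. -/
inductive SameShape : List ℕ → List ℕ → Prop
  | nil : SameShape [] []
  | node {α β α' β' : List ℕ} {n n' : ℕ} (hα : ∀ x ∈ α, x < n) (hβ : ∀ x ∈ β, x < n)
      (hα' : ∀ x ∈ α', x < n') (hβ' : ∀ x ∈ β', x < n')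
      (sα : SameShape α α') (sβ : SameShape β β') :
      SameShape (α ++ n :: β) (α' ++ n' :: β')

theorem SameShape.length_eq {l l' : List ℕ} (h : SameShape l l') : l.length = l'.length := by
  induction h with
  | nil => rfl
  | node _ _ _ _ _ _ ih1 ih2 => simp [ih1, ih2]

theorem SameShape.map_add_right {l l' : List ℕ} (h : SameShape l l') (k : ℕ) :
    SameShape l (l'.map (· + k)) := by
  induction h with
  | nil => exact .nil
  | node hα hβ hα' hβ' _ _ ih1 ih2 =>
    rw [List.map_append, List.map_cons]
    refine .node hα hβ ?_ ?_ ih1 ih2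
    · simpa using hα'
    · simpa using hβ'

theorem SameShape.map_add_left {l l' : List ℕ} (h : SameShape l l') (k : ℕ) :
    SameShape (l.map (· + k)) l' := by
  induction h with
  | nil => exact .nil
  | node hα hβ hα' hβ' _ _ ih1 ih2 =>
    rw [List.map_append, List.map_cons]
    refine .node ?_ ?_ hα' hβ' ih1 ih2
    · simpa using hα
    · simpa using hβ

theorem SameShape.compat {f : ℕ → ℕ} {l l' : List ℕ} (h : SameShape l l') (hf : l' = l.map f) :
    Compat f l := by
  induction h with
  | nil => exact .nil
  | node hα hβ hα' hβ' sα _ ih1 ih2 =>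
    rw [List.map_append, List.map_cons] at hf
    obtain ⟨h1, h2⟩ := List.append_inj hf (by simp [sα.length_eq])
    obtain ⟨rfl, h3⟩ := List.cons.inj h2
    subst h1 h3
    exact .node hα hβ (by simpa using hα') (by simpa using hβ') (ih1 rfl) (ih2 rfl)

theorem append_cons_inj_of_lt {α β α' β' : List ℕ} {n n' : ℕ}
    (hα : ∀ x ∈ α, x < n) (hβ : ∀ x ∈ β, x < n)
    (hα' : ∀ x ∈ α', x < n') (hβ' : ∀ x ∈ β', x < n')
    (h : α ++ n :: β = α' ++ n' :: β') : α = α' ∧ n = n' ∧ β = β' := by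
  refine ⟨?_, ?_, ?_⟩
  · rw [← beforeMax_eq hα hβ, h, beforeMax_eq hα' hβ']
  · rw [← maxVal_eq hα hβ, h, maxVal_eq hα' hβ']
  · rw [← afterMax_eq hα hβ, h, afterMax_eq hα' hβ']

theorem Compat.of_node {f : ℕ → ℕ} {α β : List ℕ} {n : ℕ} (h : Compat f (α ++ n :: β))
    (hα : ∀ x ∈ α, x < n) (hβ : ∀ x ∈ β, x < n) :
    (∀ x ∈ α, f x < f n) ∧ (∀ x ∈ β, f x < f n) ∧ Compat f α ∧ Compat f β := by
  generalize hl : α ++ n :: β = l at h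
  cases h with
  | nil => simp at hl
  | node hα' hβ' hfα hfβ cα cβ =>
    obtain ⟨rfl, rfl, rfl⟩ := append_cons_inj_of_lt hα hβ hα' hβ' hl
    exact ⟨hfα, hfβ, cα, cβ⟩

/-- Whether one position is an ancestor of another depends only on the factor between them: the
ancestor must be its maximum. So a factor of a word has no new ancestor pairs. -/
theorem Compat.of_append {f : ℕ → ℕ} {u v : List ℕ} (h : Compat f (u ++ v)) :
    Compat f u ∧ Compat f v := by
  generalize hl : u ++ v = l at h
  induction h generalizing u v with
  | nil =>
    obtain ⟨rfl, rfl⟩ := List.append_eq_nil_iff.mp hl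
    exact ⟨.nil, .nil⟩
  | @node α β n hα hβ hfα hfβ cα cβ ih1 ih2 =>
    rcases List.append_eq_append_iff.mp hl with ⟨w, rfl, rfl⟩ | ⟨w, rfl, hw⟩
    · obtain ⟨c1, c2⟩ := ih1 rfl
      refine ⟨c1, .node ?_ hβ ?_ hfβ c2 cβ⟩
      · exact fun x hx => hα x (List.mem_append_right _ hx)
      · exact fun x hx => hfα x (List.mem_append_right _ hx)
    · cases w with
      | nil =>
        rw [List.nil_append] at hw
        subst hw
        rw [List.append_nil]
        -- The cut falls just before the maximum, which heads the second factor with empty left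
        -- part.
        exact ⟨cα, .node (α := []) (by simp) hβ (by simp) hfβ .nil cβ⟩
      | cons y w =>
        obtain ⟨rfl, rfl⟩ := List.cons.inj hw
        obtain ⟨c1, c2⟩ := ih2 rfl
        refine ⟨.node hα ?_ hfα ?_ cα c1, c2⟩
        · exact fun x hx => hβ x (List.mem_append_left _ hx)
        · exact fun x hx => hfβ x (List.mem_append_left _ hx)

theorem Compat.reverse {f : ℕ → ℕ} {l : List ℕ} (h : Compat f l) : Compat f l.reverse := by
  induction h with
  | nil => exact .nil
  | node hα hβ hfα hfβ _ _ ih1 ih2 =>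
    rw [List.reverse_append, List.reverse_cons, List.append_assoc, List.singleton_append]
    exact .node (by simpa using hβ) (by simpa using hα) (by simpa using hfβ)
      (by simpa using hfα) ih2 ih1

theorem Compat.Tin_map {f : ℕ → ℕ} {l : List ℕ} (h : Compat f l) :
    Tin (l.map f) = (Tin l).map f := by
  induction h with
  | nil => simp [Tin, BinaryTree.map]
  | node hα hβ hfα hfβ _ _ ih1 ih2 =>
    rw [List.map_append, List.map_cons, Tin_eq hα hβ,
      Tin_eq (by simpa using hfα) (by simpa using hfβ), ih1, ih2, BinaryTree.map]

theorem Compat.S_map {f : ℕ → ℕ} {l : List ℕ} (h : Compat f l) :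
    S (l.map f) = (S l).map f := by
  induction h with
  | nil => simp [S]
  | node hα hβ hfα hfβ _ _ ih1 ih2 =>
    rw [List.map_append, List.map_cons, S_eq hα hβ,
      S_eq (by simpa using hfα) (by simpa using hfβ), ih1, ih2]
    simp

theorem Compat.leftInverse {f g : ℕ → ℕ} {l : List ℕ} (h : Compat f l)
    (hg : ∀ x ∈ l, g (f x) = x) : Compat g (l.map f) := by
  induction h with
  | nil => exact .nil
  | @node α β n hα hβ hfα hfβ _ _ ih1 ih2 =>
    have hgα : ∀ x ∈ α, g (f x) = x := fun x hx => hg x (by simp [hx])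
    have hgβ : ∀ x ∈ β, g (f x) = x := fun x hx => hg x (by simp [hx])
    have hgn : g (f n) = n := hg n (by simp)
    rw [List.map_append, List.map_cons]
    refine .node (by simpa using hfα) (by simpa using hfβ) ?_ ?_ (ih1 hgα) (ih2 hgβ)
    · simp only [List.mem_map, forall_exists_index, and_imp, forall_apply_eq_imp_iff₂]
      intro x hx
      rw [hgα x hx, hgn]
      exact hα x hx
    · simp only [List.mem_map, forall_exists_index, and_imp, forall_apply_eq_imp_iff₂]
      intro x hx
      rw [hgβ x hx, hgn]
      exact hβ x hx

/-! ### Pulling compatibility back through `S` and compositions -/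

theorem le_maxVal {l : List ℕ} {x : ℕ} (hx : x ∈ l) : x ≤ maxVal l := by
  induction l with
  | nil => simp at hx
  | cons y ys ih =>
    have h : maxVal (y :: ys) = max y (maxVal ys) := rfl
    rw [h]
    rcases List.mem_cons.mp hx with rfl | hx
    · exact le_max_left _ _
    · exact (ih hx).trans (le_max_right _ _)

theorem exists_eq_append_max {l : List ℕ} (hl : l.Nodup) (h : l ≠ []) :
    ∃ α β n, l = α ++ n :: β ∧ (∀ x ∈ α, x < n) ∧ (∀ x ∈ β, x < n) := by
  obtain ⟨α, β, hαβ⟩ := List.append_of_mem (maxVal_mem h)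
  have hne : maxVal l ∉ α ++ β := by
    rw [hαβ] at hl
    exact (List.nodup_cons.mp (List.nodup_middle.mp hl)).1
  have hlt : ∀ x ∈ α ++ β, x < maxVal l := by
    intro x hx
    have h1 : x ∈ l := by
      rw [hαβ]
      rcases List.mem_append.mp hx with h | h <;> simp [h]
    exact lt_of_le_of_ne (le_maxVal h1) (fun e => hne (e ▸ hx))
  exact ⟨α, β, maxVal l, hαβ, fun x hx => hlt x (by simp [hx]), fun x hx => hlt x (by simp [hx])⟩

/-- Induction on words of distinct values along the decomposition `α n β`. -/
theorem nodup_induction {p : (l : List ℕ) → l.Nodup → Prop} (nil : p [] List.nodup_nil)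
    (node : ∀ (α β : List ℕ) (n : ℕ), (∀ x ∈ α, x < n) → (∀ x ∈ β, x < n) →
      ∀ (hd : (α ++ n :: β).Nodup), p α hd.of_append_left → p β hd.of_append_right.of_cons →
      p (α ++ n :: β) hd) (l : List ℕ) (hl : l.Nodup) : p l hl := by
  induction hk : l.length using Nat.strong_induction_on generalizing l with
  | _ k ih =>
    by_cases h : l = []
    · subst h
      exact nil
    · obtain ⟨α, β, n, rfl, hα, hβ⟩ := exists_eq_append_max hl h
      simp only [List.length_append, List.length_cons] at hk
      exact node α β n hα hβ hl (ih _ (by omega) α _ rfl) (ih _ (by omega) β _ rfl)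

theorem S_perm {l : List ℕ} (hl : l.Nodup) : (S l).Perm l := by
  induction l, hl using nodup_induction with
  | nil => simp [S]
  | node α β n hα hβ _ ih1 ih2 =>
    rw [S_eq hα hβ, List.append_assoc]
    exact ih1.append ((List.perm_append_singleton n (S β)).trans (ih2.cons n))

/-- In `S α ++ S β ++ [n]` the last letter is an ancestor of all others, and the ancestor pairs
inside `S α` and `S β` survive because these are factors. -/
theorem Compat.of_S {f : ℕ → ℕ} {l : List ℕ} (hl : l.Nodup) (h : Compat f (S l)) :
    Compat f l := by
  induction l, hl using nodup_induction with
  | nil => exact .nil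
  | node α β n hα hβ hd ih1 ih2 =>
    have pα := S_perm hd.of_append_left
    have pβ := S_perm hd.of_append_right.of_cons
    rw [S_eq hα hβ] at h
    have hlt : ∀ x ∈ S α ++ S β, x < n := by
      intro x hx
      rcases List.mem_append.mp hx with hx | hx
      · exact hα x (pα.mem_iff.mp hx)
      · exact hβ x (pβ.mem_iff.mp hx)
    obtain ⟨hf, -, hc, -⟩ := h.of_node hlt (by simp)
    exact .node hα hβ
      (fun x hx => hf x (List.mem_append_left _ (pα.mem_iff.mpr hx)))
      (fun x hx => hf x (List.mem_append_right _ (pβ.mem_iff.mpr hx)))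
      (ih1 hc.of_append.1) (ih2 hc.of_append.2)

theorem IsComposition.perm {A : List ℕ → List ℕ} (hA : IsComposition A) {l : List ℕ}
    (hl : l.Nodup) : (A l).Perm l := by
  induction hA generalizing l with
  | ident => exact .refl _
  | stack => exact S_perm hl
  | rev => exact List.reverse_perm l
  | comp _ _ ih1 ih2 => exact (ih1 ((ih2 hl).nodup_iff.mpr hl)).trans (ih2 hl)

/-- Relabelings compatible with `A l` are compatible with `l` and commute with `A`. -/
theorem IsComposition.compat {A : List ℕ → List ℕ} (hA : IsComposition A) {f : ℕ → ℕ}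
    {l : List ℕ} (hl : l.Nodup) (h : Compat f (A l)) :
    Compat f l ∧ A (l.map f) = (A l).map f := by
  induction hA generalizing l with
  | ident => exact ⟨h, rfl⟩
  | stack => exact ⟨h.of_S hl, (h.of_S hl).S_map⟩
  | rev => exact ⟨by simpa [R] using h.reverse, by simp [R]⟩
  | comp _ hB ih1 ih2 =>
    obtain ⟨h1, h2⟩ := ih1 ((hB.perm hl).nodup_iff.mpr hl) h
    obtain ⟨h3, h4⟩ := ih2 hl h1
    refine ⟨h3, ?_⟩
    rw [Function.comp_apply, h4, h2, Function.comp_apply]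

/-! ### Permutations, `231`-avoidance and the shape of `P π` -/

theorem IsPermutation.nodup {π : List ℕ} (h : IsPermutation π) : π.Nodup :=
  h.nodup_iff.mpr List.nodup_range'

theorem isPermutation_of_bounds {l : List ℕ} (hl : l.Nodup)
    (h : ∀ x ∈ l, 1 ≤ x ∧ x ≤ l.length) : IsPermutation l := by
  refine (hl.subperm ?_).perm_of_length_le (by simp)
  intro x hx
  have := h x hx
  rw [List.mem_range'_1]
  omega

theorem IsPermutation.bounds {π : List ℕ} (h : IsPermutation π) {x : ℕ} (hx : x ∈ π) :
    1 ≤ x ∧ x ≤ π.length := by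
  have h1 := h.mem_iff.mp hx
  rw [List.mem_range'_1] at h1
  omega

theorem IsPermutation.oplus {α β : List ℕ} (hα : IsPermutation α) (hβ : IsPermutation β) :
    IsPermutation (oplus α β) := by
  apply isPermutation_of_bounds
  · refine List.Nodup.append hα.nodup (hβ.nodup.map (add_left_injective _)) ?_
    intro x hx hx'
    obtain ⟨y, hy, rfl⟩ := List.mem_map.mp hx'
    have h1 := hα.bounds hx
    have h2 := hβ.bounds hy
    omega
  · intro x hx
    simp only [StackSort.oplus, List.length_append, List.length_map]
    rcases List.mem_append.mp hx with hx | hx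
    · have := hα.bounds hx
      omega
    · obtain ⟨y, hy, rfl⟩ := List.mem_map.mp hx
      have := hβ.bounds hy
      omega

theorem IsPermutation.ominus {α β : List ℕ} (hα : IsPermutation α) (hβ : IsPermutation β) :
    IsPermutation (ominus α β) := by
  apply isPermutation_of_bounds
  · refine List.Nodup.append (hα.nodup.map (add_left_injective _)) hβ.nodup ?_
    intro x hx hx'
    obtain ⟨y, hy, rfl⟩ := List.mem_map.mp hx
    have h1 := hα.bounds hy
    have h2 := hβ.bounds hx'
    omega
  · intro x hx
    simp only [StackSort.ominus, List.length_append, List.length_map]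
    rcases List.mem_append.mp hx with hx | hx
    · obtain ⟨y, hy, rfl⟩ := List.mem_map.mp hx
      have := hα.bounds hy
      omega
    · have := hβ.bounds hx
      omega

theorem Avoids231.sublist {l l' : List ℕ} (h : Avoids231 l) (hs : l'.Sublist l) :
    Avoids231 l' :=
  fun a b c hab hbc hl => h a b c hab hbc (hl.trans hs)

theorem Avoids231.map_sub {l : List ℕ} (h : Avoids231 l) (k : ℕ) :
    Avoids231 (l.map (· - k)) := by
  intro a b c hab hbc hl
  obtain ⟨l', hs, he⟩ := List.sublist_map_iff.mp hl
  match l', he with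
  | [b', c', a'], he =>
    simp only [List.map_cons, List.map_nil, List.cons.injEq, and_true] at he
    exact h a' b' c' (by omega) (by omega) hs

/-- Otherwise `x n y` would be an occurrence of `231`. -/
theorem Avoids231.lt_of_mem {α β : List ℕ} {n : ℕ} (h : Avoids231 (α ++ n :: β))
    (hα : ∀ x ∈ α, x < n) (hd : (α ++ n :: β).Nodup) {x y : ℕ} (hx : x ∈ α) (hy : y ∈ β) :
    x < y := by
  by_contra hxy
  have hne : x ≠ y := by
    rintro rfl
    exact List.disjoint_of_nodup_append hd hx (List.mem_cons_of_mem _ hy)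
  refine h y x n (by omega) (hα x hx) ?_
  exact (List.singleton_sublist.mpr hx).append ((List.singleton_sublist.mpr hy).cons_cons n)

/-- A nonempty `231`-avoiding permutation `α n β` is `α ⊕ (1 ⊖ (β - |α|))`. -/
theorem IsPermutation.decompose {α β : List ℕ} {n : ℕ} (h : IsPermutation (α ++ n :: β))
    (hav : Avoids231 (α ++ n :: β)) (hα : ∀ x ∈ α, x < n) (hβ : ∀ x ∈ β, x < n) :
    IsPermutation α ∧ IsPermutation (β.map (· - α.length)) ∧
      (β.map (· - α.length)).map (· + α.length) = β := by
  have hd := h.nodup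
  have dα : α.Nodup := hd.of_append_left
  have dβ : β.Nodup := hd.of_append_right.of_cons
  have hlt : ∀ x ∈ α, ∀ y ∈ β, x < y := fun x hx y hy => hav.lt_of_mem hα hd hx hy
  have hnb := h.bounds (x := n) (by simp)
  simp only [List.length_append, List.length_cons] at hnb
  have bα : ∀ x ∈ α, 1 ≤ x ∧ x ≤ α.length := by
    intro x hx
    refine ⟨(h.bounds (by simp [hx])).1, ?_⟩
    -- Values up to `x` can be neither `n` nor in `β`, so all lie in `α`; counting them gives `x ≤
    -- |α|`.
    have hs : List.range' 1 x ⊆ α := by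
      intro z hz
      rw [List.mem_range'_1] at hz
      have hxn := hα x hx
      have hz' : z ∈ α ++ n :: β := by
        rw [h.mem_iff, List.mem_range'_1, List.length_append, List.length_cons]
        omega
      rcases List.mem_append.mp hz' with hz' | hz'
      · exact hz'
      · rcases List.mem_cons.mp hz' with rfl | hz'
        · omega
        · have := hlt x hx z hz'
          omega
    simpa using (List.Nodup.subperm List.nodup_range' hs).length_le
  have bβ : ∀ y ∈ β, α.length < y := by
    intro y hy
    have hy1 := (h.bounds (x := y) (by simp [hy])).1
    have hs : α ⊆ List.range' 1 (y - 1) := by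
      intro z hz
      have h1 := hlt z hz y hy
      have h2 := (bα z hz).1
      rw [List.mem_range'_1]
      omega
    have h1 := (dα.subperm hs).length_le
    rw [List.length_range'] at h1
    omega
  refine ⟨isPermutation_of_bounds dα bα, isPermutation_of_bounds ?_ ?_, ?_⟩
  · refine dβ.map_on ?_
    intro x hx y hy hxy
    have h1 := bβ x hx
    have h2 := bβ y hy
    omega
  · intro x hx
    obtain ⟨y, hy, rfl⟩ := List.mem_map.mp hx
    have h1 := bβ y hy
    have h2 := hβ y hy
    rw [List.length_map]
    omega
  · rw [List.map_map]
    conv_rhs => rw [← List.map_id β]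
    refine List.map_congr_left ?_
    intro y hy
    have h1 := bβ y hy
    simp only [Function.comp_apply, id_eq]
    omega

theorem isPermutation_singleton : IsPermutation [1] := by
  simp [IsPermutation]

/-- Both claims are proved together: the bounds on the letters of `P α` and `P β` show that the
inserted letter is the maximum, hence the root. -/
theorem P_spec {π : List ℕ} (h : IsPermutation π) (hav : Avoids231 π) :
    IsPermutation (P π) ∧ SameShape π (P π) := by
  induction hk : π.length using Nat.strong_induction_on generalizing π with
  | _ k ih =>
    by_cases hπ : π = []
    · subst hπ
      rw [P, dif_pos rfl]
      exact ⟨h, .nil⟩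
    · obtain ⟨α, β, n, rfl, hα, hβ⟩ := exists_eq_append_max h.nodup hπ
      obtain ⟨pα, pβ, hβ'⟩ := h.decompose hav hα hβ
      simp only [List.length_append, List.length_cons] at hk
      obtain ⟨pPα, sα⟩ := ih _ (by omega) pα (hav.sublist (List.sublist_append_left _ _)) rfl
      obtain ⟨pPβ, sβ⟩ := ih (β.map (· - α.length)).length (by simp; omega) pβ
        ((hav.sublist ((List.sublist_cons_self n β).trans
          (List.sublist_append_right _ _))).map_sub _) rfl
      rw [P, dif_neg hπ, beforeMax_eq hα hβ, afterMax_eq hα hβ]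
      refine ⟨(pPα.oplus isPermutation_singleton).ominus pPβ, ?_⟩
      -- Shifting all labels does not affect shape, so the normalized `β` can be replaced by `β`
      -- itself.
      have sβ' := sβ.map_add_left α.length
      rw [hβ'] at sβ'
      simp only [ominus, oplus, List.map_append, List.map_cons, List.map_nil, List.append_assoc,
        List.singleton_append]
      refine .node hα hβ ?_ ?_ (sα.map_add_right _) sβ'
      · intro x hx
        obtain ⟨y, hy, rfl⟩ := List.mem_map.mp hx
        have := pPα.bounds hy
        omega
      · intro x hx
        have := pPβ.bounds hx
        omega

theorem P_eq_map_lam {π : List ℕ} (hd : π.Nodup) (hl : π.length = (P π).length) :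
    P π = π.map (lam π) := by
  refine List.ext_getElem (by simp [hl]) ?_
  intro i h1 h2
  rw [List.length_map] at h2
  -- Equal lengths keep the index in range, so the default of `getD` is never used.
  simp [lam, hd.idxOf_getElem, h1]

end StackSort

/-! ### The main theorem -/

open StackSort

theorem mainTheorem2 (A : List ℕ → List ℕ) (hA : StackSort.IsComposition A) :
    StackSort.RespectsP A := by
  intro π hπ hav _
  obtain ⟨hP, hs⟩ := P_spec hπ hav
  have hmap := P_eq_map_lam hπ.nodup hs.length_eq
  have hc : Compat (lam π) π := hs.compat hmap
  have hinj : ∀ x ∈ π, ∀ y ∈ π, lam π x = lam π y → x = y :=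
    List.inj_on_of_nodup_map (hmap ▸ hP.nodup)
  obtain ⟨g, hg⟩ : ∃ g : ℕ → ℕ, ∀ x ∈ π, g (lam π x) = x :=
    ⟨Function.invFunOn (lam π) {x | x ∈ π}, fun x hx =>
      Set.InjOn.leftInvOn_invFunOn (fun x hx y hy => hinj x hx y hy) hx⟩
  have hperm : ∀ {ρ θ : List ℕ}, θ ∈ preimages A ρ → θ.Perm ρ := by
    rintro ρ θ ⟨h1, rfl⟩
    exact (hA.perm h1.nodup).symm
  have hphi : ∀ θ ∈ preimages A π, Phi A θ = θ.map (lam π) := by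
    rintro θ ⟨_, rfl⟩
    rfl
  have hkey : ∀ θ ∈ preimages A π,
      Compat (lam π) θ ∧ A (θ.map (lam π)) = P π := by
    rintro θ ⟨h1, h2⟩
    have h := hA.compat (f := lam π) h1.nodup (h2 ▸ hc)
    rw [h2, ← hmap] at h
    exact h
  refine ⟨fun θ hθ => ?_, fun θ hθ => ?_, fun θ hθ θ' hθ' he => ?_, fun θ' hθ' => ?_⟩
  · rw [hphi θ hθ]
    exact ⟨(hkey θ hθ).2, hmap, rfl, (hkey θ hθ).1.Tin_map⟩
  · rw [hphi θ hθ]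
    refine ⟨?_, (hkey θ hθ).2⟩
    have h1 : (θ.map (lam π)).Perm (P π) := hmap ▸ (hperm hθ).map _
    rw [IsPermutation, h1.length_eq]
    exact h1.trans hP
  · rw [hphi θ hθ, hphi θ' hθ'] at he
    have hcancel : ∀ {ρ : List ℕ}, ρ ∈ preimages A π → (ρ.map (lam π)).map g = ρ := by
      intro ρ hρ
      rw [List.map_map]
      conv_rhs => rw [← List.map_id ρ]
      exact List.map_congr_left (fun x hx => hg x ((hperm hρ).mem_iff.mp hx))
    rw [← hcancel hθ, he, hcancel hθ']
  · have hgπ : (P π).map g = π := by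
      rw [hmap, List.map_map]
      conv_rhs => rw [← List.map_id π]
      exact List.map_congr_left hg
    -- Surjectivity: transporting `θ'` along `g` gives its preimage.
    have hcg : Compat g (P π) := hmap ▸ hc.leftInverse hg
    obtain ⟨h1, h2⟩ := hθ'
    have h3 := (hA.compat (f := g) h1.nodup (h2 ▸ hcg)).2
    rw [h2, hgπ] at h3
    have h4 : (θ'.map g).Perm π := hgπ ▸ (hperm ⟨h1, h2⟩).map g
    have h5 : θ'.map g ∈ preimages A π := by
      refine ⟨?_, h3⟩
      rw [IsPermutation, h4.length_eq]
      exact h4.trans hπ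
    refine ⟨θ'.map g, h5, ?_⟩
    rw [hphi _ h5, List.map_map]
    conv_rhs => rw [← List.map_id θ']
    refine List.map_congr_left ?_
    intro y hy
    have hy' : y ∈ P π := (hperm ⟨h1, h2⟩).mem_iff.mp hy
    rw [hmap] at hy'
    obtain ⟨x, hx, rfl⟩ := List.mem_map.mp hy'
    simp [hg x hx]
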